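/- Let $\Lambda$ be a finite set of labels. A graph here is a finite, connected, undirected simple graph $G=(V,E,\lambda)$ with at least three nodes and a labelling $\lambda:V\to\Lambda$; its label count $L_G\in\mathbb{N}^\Lambda$ is $L_G(x)=|\{v\in V:\lambda(v)=x\}|$. For a multiset $M\in\mathbb{N}^X$ and $K\in\mathbb{N}$ let $\lceil M\rceil_K(x)=\min(M(x),K)$. A non-counting machine is a tuple $(Q,\delta_0,\delta,Y,N)$ with a finite set $Q$ of states, $\delta_0:\Lambda\to Q$, $\delta:Q\times\{0,1\}^Q\to Q$, and disjoint sets $Y,N\subseteq Q$. On a graph $G$ it starts in the configuration $v\mapsto\delta_0(\lambda(v))$. When a node $v$ is selected in a configuration $C:V\to Q$, its state becomes $\delta(C(v),\mathcal N)$, where $\mathcal N(q)=1$ if some neighbour of $v$ is in state $q$ and $\mathcal N(q)=0$ otherwise; all other nodes keep their states. A schedule selects exactly one node in each step; it is pseudo-stochastic if every finite sequence of nodes occurs in it infinitely often as a contiguous block. A run is accepting (rejecting) if from some time on all nodes are always in states of $Y$ (of $N$). A dAF-automaton is a non-counting machine such that for every graph $G$, either all runs on $G$ with pseudo-stochastic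 schedules are accepting ($G$ is accepted), or all of them are rejecting ($G$ is rejected). It decides the labelling property $\varphi:\mathbb{N}^\Lambda\to\{0,1\}$ if, for every graph $G$, it accepts $G$ if and only if $\varphi(L_G)=1$. **Proposition.** A labelling property $\varphi:\mathbb{N}^\Lambda\to\{0,1\}$ is decided by some dAF-automaton if and only if there is $K\in\mathbb{N}$ such that $\varphi(L)=\varphi(\lceil L\rceil_K)$ for all $L\in\mathbb{N}^\Lambda$. -/

import Mathlib

open Filter

namespace DistAut

/-- A multiset over `X` is a function `X → ℕ`; `cutoff K M` replaces every value above `K` by `K`. -/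
def cutoff {X : Type*} (K : ℕ) (M : X → ℕ) : X → ℕ := fun x => min (M x) K

/-- A graph labelled by `Λ`: finite, simple, undirected, connected, with at least three nodes. -/
structure LGraph (Λ : Type*) where
  V : Type
  finite : Finite V
  graph : SimpleGraph V
  label : V → Λ
  connected : graph.Connected
  three_le : 3 ≤ Nat.card V

/-- The label count `L_G`. -/
noncomputable def LGraph.labelCount {Λ : Type*} (G : LGraph Λ) : Λ → ℕ :=
  fun x => {v : G.V | G.label v = x}.ncard

/-- A distributed machine with input alphabet `Λ` and counting bound `β`;
`Fin (β + 1)` is the interval `{0, …, β}`. -/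
structure Machine (Λ : Type*) (β : ℕ) where
  Q : Type
  finite : Finite Q
  init : Λ → Q
  δ : Q → (Q → Fin (β + 1)) → Q
  Y : Set Q
  N : Set Q
  disjoint : Disjoint Y N

namespace Machine

variable {Λ : Type*} {β : ℕ} (M : Machine Λ β) (G : LGraph Λ)

/-- A configuration of the machine on `G`. -/
abbrev Config : Type := G.V → M.Q

variable {G}

/-- The number of neighbours of `v` in each state. -/
noncomputable def neighbourCount (C : M.Config G) (v : G.V) : M.Q → ℕ :=
  fun q => {u : G.V | G.graph.Adj v u ∧ C u = q}.ncard

/-- The neighbourhood function: the number of neighbours in each state, cut off at `β`. -/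
noncomputable def neighbourhood (C : M.Config G) (v : G.V) : M.Q → Fin (β + 1) :=
  fun q => ⟨cutoff β (M.neighbourCount C v) q, Nat.lt_succ_of_le (min_le_right _ _)⟩

open Classical in
/-- The successor of `C` via the selection `S`. -/
noncomputable def succ (C : M.Config G) (S : Set G.V) : M.Config G :=
  fun v => if v ∈ S then M.δ (C v) (M.neighbourhood C v) else C v

variable (G) in
/-- The run scheduled by `σ`. -/
noncomputable def run (σ : ℕ → Set G.V) : ℕ → M.Config G
  | 0 => fun v => M.init (G.label v)
  | t + 1 => M.succ (run σ t) (σ t)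

/-- Every node is eventually always in an accepting state (stable consensus). -/
def AcceptingRun (ρ : ℕ → M.Config G) : Prop :=
  ∃ t, ∀ t' ≥ t, ∀ v, ρ t' v ∈ M.Y

/-- Every node is eventually always in a rejecting state (stable consensus). -/
def RejectingRun (ρ : ℕ → M.Config G) : Prop :=
  ∃ t, ∀ t' ≥ t, ∀ v, ρ t' v ∈ M.N

end Machine

/-- A scheduler: permitted selections for every graph, and a set of fair schedules made of
permitted selections, each selecting every node infinitely often. -/
structure Scheduler (Λ : Type*) where
  permitted : ∀ G : LGraph Λ, Set (Set G.V)
  covers : ∀ (G : LGraph Λ) (v : G.V), ∃ S ∈ permitted G, v ∈ S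
  fair : ∀ G : LGraph Λ, Set (ℕ → Set G.V)
  fair_permitted : ∀ (G : LGraph Λ), ∀ σ ∈ fair G, ∀ t, σ t ∈ permitted G
  fair_schedule : ∀ (G : LGraph Λ), ∀ σ ∈ fair G, ∀ v, ∃ᶠ t in atTop, v ∈ σ t

/-- Exclusive selection: exactly one node is selected in each step. -/
def Scheduler.Exclusive {Λ : Type*} (s : Scheduler Λ) : Prop :=
  ∀ G : LGraph Λ, s.permitted G = Set.range (fun v : G.V => ({v} : Set G.V))

/-- A sequence of selections from `P` in which each finite word over `P` occurs infinitely often. -/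
def PseudoStochastic {V : Type*} (P : Set (Set V)) (σ : ℕ → Set V) : Prop :=
  (∀ t, σ t ∈ P) ∧
    ∀ w : List (Set V), (∀ S ∈ w, S ∈ P) →
      ∃ᶠ t in atTop, ∀ i : Fin w.length, σ (t + i) = w.get i

/-- The fair schedules are precisely the pseudo-stochastic ones. -/
def Scheduler.IsPseudoStochastic {Λ : Type*} (s : Scheduler Λ) : Prop :=
  ∀ G : LGraph Λ, s.fair G = {σ | PseudoStochastic (s.permitted G) σ}

/-- A distributed automaton: a machine and a scheduler satisfying the consistency condition. -/
structure Automaton (Λ : Type*) (β : ℕ) where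
  machine : Machine Λ β
  scheduler : Scheduler Λ
  consistent : ∀ G : LGraph Λ,
    (∀ σ ∈ scheduler.fair G, machine.AcceptingRun (machine.run G σ)) ∨
    (∀ σ ∈ scheduler.fair G, machine.RejectingRun (machine.run G σ))

namespace Automaton

variable {Λ : Type*} {β : ℕ}

/-- `A` accepts `G` if some fair run is accepting. -/
def Accepts (A : Automaton Λ β) (G : LGraph Λ) : Prop :=
  ∃ σ ∈ A.scheduler.fair G, A.machine.AcceptingRun (A.machine.run G σ)

/-- `A` decides the labelling property given by `φ : ℕ^Λ → {0,1}`. -/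
def Decides (A : Automaton Λ β) (φ : (Λ → ℕ) → Prop) : Prop :=
  ∀ G : LGraph Λ, A.Accepts G ↔ φ G.labelCount

end Automaton

/-- The labelling properties decided by automata of the class dAF: non-counting (`β = 1`),
acceptance by stable consensus, pseudo-stochastic scheduling, with exclusive selection. -/
def decidedByDAF (Λ : Type*) : Set ((Λ → ℕ) → Prop) :=
  {φ | ∃ A : Automaton Λ 1,
    A.scheduler.Exclusive ∧ A.scheduler.IsPseudoStochastic ∧ A.Decides φ}

/-- The labelling properties that admit a cutoff. -/
def Cutoff (Λ : Type*) : Set ((Λ → ℕ) → Prop) :=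
  {φ | ∃ K : ℕ, ∀ L : Λ → ℕ, φ L ↔ φ (cutoff K L)}

end DistAut

/-!
The theorem says that the automata of the class dAF decide exactly the labelling properties with a
cutoff. Both inclusions treat a fair run as a reachability problem: there are finitely many
configurations, so a single word of selections leads every configuration of a closed set through any
target that all of them can reach (`Machine.exists_universal_word`), and this word occurs infinitely
often in a fair schedule. Hence a run settles in `Y` or in `N` precisely when a configuration that
is stable for that set is reached.

*Deciding implies a cutoff.* Consider stars. A leaf sees only the centre, and the centre sees only
which states occur among the leaves, so a star in which every leaf is replaced by several copies can
imitate the original one (`Machine.exists_word_star`). Therefore the configurations from which a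
node can leave `P` form an upward closed set, as long as the centre and the set of occupied states
are kept, and by Dickson's lemma stability depends on the numbers of leaves up to a bound `m` only
(`Machine.exists_bound_stable`). If a label occurs more than `m * |Q|` times among the leaves, then
some state is taken by more than `m` of these leaves in the stable configuration, and one more leaf
with this label changes nothing (`Machine.exists_word_stable_add_leaf`).

*A cutoff implies deciding.* It suffices to decide thresholds, "at least `k` nodes are labelled `x`",
since the machines for finitely many thresholds can run side by side (`prodMachine_run`). The nodes
labelled `x` start on level `1`. Nodes have clocks, of which they show the residue modulo three; a
node ticks only if no neighbour is behind, so that the clocks of neighbours differ by at most one.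
With each tick, a node either emits its own level as a signal or passes on the signal of a neighbour
that is one tick ahead, and in the latter case a node on the level named by the signal rises by one
level. A node rises only if another node stays on the level that it leaves; thus the occupied levels
have no gaps and level `k` is out of reach of fewer than `k` nodes (`thresholdMachine.Good.succ_move`,
`thresholdMachine.Good.level_le`). Conversely, if there are at least `k` nodes labelled `x` and none
is on level `k`, then two of them share a level, and one of them can emit a signal that makes some
node rise (`thresholdMachine.Good.exists_word_level_ne`). Level `k` is contagious, and means
acceptance.
-/

/-! ### Runs under fair schedules -/

namespace DistAut

instance {Λ : Type*} (G : LGraph Λ) : Finite G.V := G.finite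

instance {Λ : Type*} {β : ℕ} (M : Machine Λ β) : Finite M.Q := M.finite

/-- The schedules that are fair for exclusive selection: they select one node at a time, and every
finite sequence of nodes occurs infinitely often. -/
abbrev FairSchedule {V : Type*} (σ : ℕ → Set V) : Prop :=
  PseudoStochastic (Set.range fun v : V => ({v} : Set V)) σ

theorem FairSchedule.exists_node {V : Type*} {σ : ℕ → Set V} (hσ : FairSchedule σ) (t : ℕ) :
    ∃ v, σ t = {v} := by
  obtain ⟨v, hv⟩ := hσ.1 t
  exact ⟨v, hv.symm⟩

theorem FairSchedule.frequently_word {V : Type*} {σ : ℕ → Set V} (hσ : FairSchedule σ)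
    (w : List V) : ∃ᶠ t in atTop, ∀ (i : ℕ) (hi : i < w.length), σ (t + i) = {w[i]} := by
  have h := hσ.2 (w.map fun v => ({v} : Set V)) (by
    intro S hS
    obtain ⟨v, -, rfl⟩ := List.mem_map.1 hS
    exact ⟨v, rfl⟩)
  refine h.mono fun t ht i hi => ?_
  simpa using ht ⟨i, by simpa using hi⟩

/-- In a countable alphabet some sequence contains every word infinitely often: play the words of
an enumeration with infinite repetitions, the `n`-th one starting at time `2 ^ n`. -/
theorem exists_sequence_frequently_word (α : Type*) [Countable α] [Nonempty α] :
    ∃ σ : ℕ → α, ∀ w : List α, ∃ᶠ t in atTop, ∀ i : Fin w.length, σ (t + i) = w.get i := by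
  obtain ⟨W, hW⟩ := exists_surjective_nat (List α)
  obtain ⟨a⟩ := ‹Nonempty α›
  refine ⟨fun t => (W (Nat.unpair (Nat.log 2 t)).1).getD (t - 2 ^ Nat.log 2 t) a, fun w => ?_⟩
  obtain ⟨j, rfl⟩ := hW w
  rw [frequently_atTop]
  intro N
  -- the exponent is at least `N` and at least the length of the word, so that the word fits
  set n := Nat.pair j (N + (W j).length) with hn
  have hle : N + (W j).length ≤ n := Nat.right_le_pair _ _
  have hlt : n < 2 ^ n := Nat.lt_two_pow_self
  refine ⟨2 ^ n, by omega, fun i => ?_⟩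
  have hi := i.2
  have hlog : Nat.log 2 (2 ^ n + i) = n := by
    rw [Nat.log_eq_iff (Or.inr ⟨by norm_num, by omega⟩)]
    constructor
    · omega
    · rw [pow_succ]; omega
  dsimp only
  rw [hlog, Nat.add_sub_cancel_left, hn, Nat.unpair_pair]
  simp

theorem exists_fairSchedule (V : Type*) [Finite V] [Nonempty V] :
    ∃ σ : ℕ → Set V, FairSchedule σ := by
  obtain ⟨σ, hσ⟩ := exists_sequence_frequently_word V
  refine ⟨fun t => {σ t}, fun t => ⟨_, rfl⟩, fun w hw => ?_⟩
  choose! f hf using hw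
  refine (hσ (w.map f)).mono fun t ht i => ?_
  have h := ht ⟨i, by simp⟩
  simp only [List.get_eq_getElem, List.getElem_map] at h
  dsimp only
  rw [h]
  exact hf _ (List.getElem_mem _)

theorem FairSchedule.exists_prefix {V : Type*} {σ : ℕ → Set V} (hσ : FairSchedule σ)
    (w : List V) :
    ∃ τ : ℕ → Set V, FairSchedule τ ∧ ∀ (i : ℕ) (hi : i < w.length), τ i = {w[i]} := by
  refine ⟨fun t => if h : t < w.length then {w[t]} else σ (t - w.length),
    ⟨fun t => ?_, fun u hu => ?_⟩, fun i hi => by simp [hi]⟩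
  · dsimp only
    split_ifs
    · exact ⟨_, rfl⟩
    · exact hσ.1 _
  · rw [frequently_atTop]
    intro N
    obtain ⟨t, htN, ht⟩ := frequently_atTop.1 (hσ.2 u hu) N
    refine ⟨t + w.length, by omega, fun i => ?_⟩
    dsimp only
    rw [dif_neg (by omega), ← ht i]
    congr 1
    omega

namespace Machine

variable {Λ : Type*} {β : ℕ} (M : Machine Λ β) {G : LGraph Λ}

/-- The configuration reached from `C` by selecting the nodes of `w` one after the other. -/
noncomputable def exec (C : M.Config G) (w : List G.V) : M.Config G :=
  w.foldl (fun D v => M.succ D {v}) C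

@[simp] theorem exec_nil (C : M.Config G) : M.exec C [] = C := rfl

@[simp] theorem exec_cons (C : M.Config G) (v : G.V) (w : List G.V) :
    M.exec C (v :: w) = M.exec (M.succ C {v}) w := rfl

theorem exec_append (C : M.Config G) (w w' : List G.V) :
    M.exec C (w ++ w') = M.exec (M.exec C w) w' := List.foldl_append

theorem exec_mem {I : Set (M.Config G)} (hI : ∀ C ∈ I, ∀ v, M.succ C {v} ∈ I)
    {C : M.Config G} (hC : C ∈ I) (w : List G.V) : M.exec C w ∈ I := by
  induction w generalizing C with
  | nil => exact hC
  | cons v w ih => exact ih (hI C hC v)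

theorem run_add_length (σ : ℕ → Set G.V) (w : List G.V) (t : ℕ)
    (h : ∀ (i : ℕ) (hi : i < w.length), σ (t + i) = {w[i]}) :
    M.run G σ (t + w.length) = M.exec (M.run G σ t) w := by
  induction w generalizing t with
  | nil => rfl
  | cons v w ih =>
    have h0 : σ t = {v} := h 0 (by simp)
    have := ih (t + 1) (fun i hi => by
      have := h (i + 1) (by simpa using hi)
      rw [add_assoc, add_comm 1 i]
      simpa using this)
    rw [List.length_cons, add_comm w.length, ← add_assoc, this, exec_cons, ← h0]
    rfl

theorem run_mem {I : Set (M.Config G)} (hI : ∀ C ∈ I, ∀ v, M.succ C {v} ∈ I)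
    {σ : ℕ → Set G.V} (hσ : FairSchedule σ) {t : ℕ} (ht : M.run G σ t ∈ I) {t' : ℕ}
    (htt : t ≤ t') : M.run G σ t' ∈ I := by
  induction t', htt using Nat.le_induction with
  | base => exact ht
  | succ s _ ih =>
    obtain ⟨v, hv⟩ := hσ.exists_node s
    change M.succ _ (σ s) ∈ I
    rw [hv]
    exact hI _ ih v

/-- If every configuration of a closed set `I` can reach `T`, then one word leads all of them
through `T`: deal with the finitely many configurations one after the other. -/
theorem exists_universal_word {I T : Set (M.Config G)} (hI : ∀ C ∈ I, ∀ v, M.succ C {v} ∈ I)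
    (h : ∀ C ∈ I, ∃ w, M.exec C w ∈ T) :
    ∃ W : List G.V, ∀ C ∈ I, ∃ w, w <+: W ∧ M.exec C w ∈ T := by
  suffices ∀ F : Set (M.Config G), F ⊆ I →
      ∃ W : List G.V, ∀ C ∈ F, ∃ w, w <+: W ∧ M.exec C w ∈ T from this I subset_rfl
  intro F
  induction F, Set.toFinite F using Set.Finite.induction_on with
  | empty => exact fun _ => ⟨[], by simp⟩
  | @insert C F _ _ ih =>
    intro hF
    obtain ⟨W, hW⟩ := ih fun D hD => hF (Set.mem_insert_of_mem _ hD)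
    obtain ⟨w, hw⟩ := h _ (M.exec_mem hI (hF (Set.mem_insert _ _)) W)
    refine ⟨W ++ w, fun D hD => ?_⟩
    obtain rfl | hD := hD
    · exact ⟨W ++ w, List.prefix_rfl, by rwa [exec_append]⟩
    · obtain ⟨u, hu, hT⟩ := hW D hD
      exact ⟨u, hu.trans (List.prefix_append _ _), hT⟩

theorem frequently_run_mem {I T : Set (M.Config G)} (hI : ∀ C ∈ I, ∀ v, M.succ C {v} ∈ I)
    (h : ∀ C ∈ I, ∃ w, M.exec C w ∈ T) {σ : ℕ → Set G.V} (hσ : FairSchedule σ)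
    (h0 : M.run G σ 0 ∈ I) : ∃ᶠ t in atTop, M.run G σ t ∈ T := by
  obtain ⟨W, hW⟩ := M.exists_universal_word hI h
  rw [frequently_atTop]
  intro N
  obtain ⟨t, htN, ht⟩ := frequently_atTop.1 (hσ.frequently_word W) N
  obtain ⟨w, hw, hT⟩ := hW _ (M.run_mem hI hσ h0 (Nat.zero_le t))
  refine ⟨t + w.length, by omega, ?_⟩
  rw [M.run_add_length]
  · exact hT
  · intro i hi
    rw [ht i (hi.trans_le hw.length_le), hw.getElem]

/-- `C` is stable for `P` if all nodes stay in states of `P` whatever is selected. -/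
def Stable (P : Set M.Q) (C : M.Config G) : Prop := ∀ w v, M.exec C w v ∈ P

theorem Stable.exec {M : Machine Λ β} {P : Set M.Q} {C : M.Config G} (h : M.Stable P C)
    (w : List G.V) : M.Stable P (M.exec C w) := by
  intro u v
  rw [← exec_append]
  exact h _ v

/-- A fair run that finally stays in `P` visits a configuration that is stable for `P`. -/
theorem exists_run_stable {P : Set M.Q} {σ : ℕ → Set G.V} (hσ : FairSchedule σ)
    (h : ∃ t, ∀ t' ≥ t, ∀ v, M.run G σ t' v ∈ P) : ∃ t, M.Stable P (M.run G σ t) := by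
  by_contra! hst
  obtain ⟨t, ht⟩ := h
  have := M.frequently_run_mem (I := Set.univ) (T := {C | (∃ v, C v ∉ P) ∨ M.Stable P C})
    (by simp) (fun C _ => by
      by_cases hC : M.Stable P C
      · exact ⟨[], Or.inr hC⟩
      · simp only [Stable, not_forall] at hC
        obtain ⟨w, v, hv⟩ := hC
        exact ⟨w, Or.inl ⟨v, hv⟩⟩) hσ (Set.mem_univ _)
  obtain ⟨t', ht', hv | hs⟩ := frequently_atTop.1 this t
  · obtain ⟨v, hv⟩ := hv
    exact hv (ht t' ht' v)
  · exact hst _ hs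

theorem exists_word_run (σ : ℕ → Set G.V) (hσ : FairSchedule σ) (t : ℕ) :
    ∃ w, M.run G σ t = M.exec (fun v => M.init (G.label v)) w := by
  induction t with
  | zero => exact ⟨[], rfl⟩
  | succ t ih =>
    obtain ⟨w, hw⟩ := ih
    obtain ⟨v, hv⟩ := hσ.exists_node t
    refine ⟨w ++ [v], ?_⟩
    rw [exec_append, ← hw]
    change M.succ _ (σ t) = _
    rw [hv]
    rfl

/-- Every configuration that is stable for `P` and reachable from the initial one lies on a
fair run, which stays in `P` from then on. -/
theorem Stable.exists_fair_run {M : Machine Λ β} {P : Set M.Q} {w : List G.V}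
    (h : M.Stable P (M.exec (fun v => M.init (G.label v)) w)) :
    ∃ σ : ℕ → Set G.V, FairSchedule σ ∧ ∃ t, ∀ t' ≥ t, ∀ v, M.run G σ t' v ∈ P := by
  have := G.connected.nonempty
  obtain ⟨σ₀, h₀⟩ := exists_fairSchedule G.V
  obtain ⟨σ, hσ, hw⟩ := h₀.exists_prefix w
  refine ⟨σ, hσ, w.length, fun t' ht' v => ?_⟩
  have hrun : M.run G σ w.length = M.exec (fun v => M.init (G.label v)) w := by
    have := M.run_add_length σ w 0 (by simpa using hw)
    rwa [zero_add] at this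
  have hmem := M.run_mem (I := {C | M.Stable P C}) (fun C hC v => Stable.exec hC [v]) hσ
    (t := w.length) (by rw [hrun]; exact h) ht'
  exact hmem [] v

end Machine
end DistAut

/-! ### Non-counting machines on stars -/

namespace DistAut

namespace Machine

variable {Λ : Type*} {β : ℕ}

/-- The set of states that occur at the neighbours of `v`. -/
def seen (M : Machine Λ β) {G : LGraph Λ} (C : M.Config G) (v : G.V) : Set M.Q :=
  {q | ∃ u, G.graph.Adj v u ∧ C u = q}

open Classical in
theorem neighbourhood_apply (M : Machine Λ 1) {G : LGraph Λ} (C : M.Config G) (v : G.V) (q : M.Q) :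
    M.neighbourhood C v q = if q ∈ M.seen C v then 1 else 0 := by
  apply Fin.ext
  change min ({u : G.V | G.graph.Adj v u ∧ C u = q}.ncard) 1 = _
  split_ifs with h
  · obtain ⟨u, hu⟩ := h
    have : 0 < {u : G.V | G.graph.Adj v u ∧ C u = q}.ncard :=
      (Set.ncard_pos (Set.toFinite _)).2 ⟨u, hu⟩
    simp only [Fin.val_one]
    omega
  · have : {u : G.V | G.graph.Adj v u ∧ C u = q} = ∅ := by
      ext u
      simp only [Set.mem_ofPred_eq, Set.mem_empty_iff_false, iff_false]
      exact fun hu => h ⟨u, hu⟩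
    simp [this]

theorem neighbourhood_congr (M : Machine Λ 1) {G G' : LGraph Λ} {C : M.Config G}
    {C' : M.Config G'} {v : G.V} {v' : G'.V} (h : M.seen C v = M.seen C' v') :
    M.neighbourhood C v = M.neighbourhood C' v' := by
  classical
  ext1 q
  rw [neighbourhood_apply, neighbourhood_apply, h]

theorem succ_singleton (M : Machine Λ β) {G : LGraph Λ} [DecidableEq G.V] (C : M.Config G)
    (v : G.V) :
    M.succ C {v} = Function.update C v (M.δ (C v) (M.neighbourhood C v)) := by
  ext u
  by_cases h : u = v
  · subst h
    simp [succ]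
  · simp [succ, h]

end Machine

/-- The star with leaves `ι`; the centre is `none`. -/
@[reducible] def star {Λ : Type*} (ι : Type) [Finite ι] (h : 2 ≤ Nat.card ι) (lab : Option ι → Λ) :
    LGraph Λ where
  V := Option ι
  finite := inferInstance
  graph :=
    { Adj := fun u v => u ≠ v ∧ (u = none ∨ v = none)
      symm := ⟨fun _ _ h => ⟨h.1.symm, h.2.symm⟩⟩
      loopless := ⟨fun _ h => h.1 rfl⟩ }
  label := lab
  connected := by
    rw [SimpleGraph.connected_iff_exists_forall_reachable]
    refine ⟨none, fun v => ?_⟩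
    obtain _ | i := v
    · rfl
    · exact SimpleGraph.Adj.reachable ⟨by simp, Or.inl rfl⟩
  three_le := by
    rw [Finite.card_option]
    omega

namespace Machine

variable {Λ : Type*} {ι κ : Type} [Finite ι] [Finite κ] {hι : 2 ≤ Nat.card ι} {hκ : 2 ≤ Nat.card κ}
  {lab : Option ι → Λ} {lab' : Option κ → Λ}

theorem seen_star_none (M : Machine Λ 1) (C : M.Config (star ι hι lab)) :
    M.seen C none = Set.range fun i => C (some i) := by
  ext q
  constructor
  · rintro ⟨u, ⟨hu, -⟩, rfl⟩
    obtain _ | i := u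
    · exact absurd rfl hu
    · exact ⟨i, rfl⟩
  · rintro ⟨i, rfl⟩
    exact ⟨some i, ⟨by simp, Or.inl rfl⟩, rfl⟩

theorem seen_star_some (M : Machine Λ 1) (C : M.Config (star ι hι lab)) (i : ι) :
    M.seen C (some i) = {C none} := by
  ext q
  constructor
  · rintro ⟨u, ⟨-, hu⟩, rfl⟩
    obtain rfl : u = none := by simpa using hu
    rfl
  · rintro rfl
    exact ⟨none, ⟨by simp, Or.inr rfl⟩, rfl⟩

/-- One step of a star is imitated by a star in which every leaf is replaced by a nonempty group
of copies: a leaf only sees the centre, so the members of a group can move one after the other,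
and the centre cannot count the members of a group. -/
theorem exists_word_succ_star (M : Machine Λ 1) (f : κ → ι) (hf : Function.Surjective f)
    (C : M.Config (star ι hι lab)) (v : Option ι) :
    ∃ w : List (Option κ),
      M.exec (G := star κ hκ lab') (fun u => C (Option.map f u)) w =
        fun u => M.succ C {v} (Option.map f u) := by
  classical
  obtain _ | i := v
  · refine ⟨[none], ?_⟩
    rw [exec_cons, exec_nil, succ_singleton, succ_singleton]
    have hs : M.seen (G := star κ hκ lab') (fun u => C (Option.map f u)) none = M.seen C none := by
      rw [seen_star_none, seen_star_none]
      exact hf.range_comp fun i => C (some i)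
    rw [M.neighbourhood_congr hs]
    ext u
    obtain _ | j := u <;> simp
  · set q := M.δ (C (some i)) (M.neighbourhood C (some i)) with hq
    have key : ∀ s : Set κ, (∀ j ∈ s, f j = i) → ∃ w : List (Option κ),
        M.exec (G := star κ hκ lab') (fun u => C (Option.map f u)) w =
          fun u => if ∃ j ∈ s, u = some j then q else C (Option.map f u) := by
      intro s
      induction s, Set.toFinite s using Set.Finite.induction_on with
      | empty => exact fun _ => ⟨[], by rw [exec_nil]; simp⟩
      | @insert j s hj _ ih =>
        intro hs
        obtain ⟨w, hw⟩ := ih fun k hk => hs k (Set.mem_insert_of_mem _ hk)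
        refine ⟨w ++ [some j], ?_⟩
        rw [exec_append, hw, exec_cons, exec_nil, succ_singleton]
        have hji : f j = i := hs j (Set.mem_insert _ _)
        have hs : M.seen (G := star κ hκ lab')
            (fun u => if ∃ j ∈ s, u = some j then q else C (Option.map f u)) (some j) =
              M.seen C (some i) := by
          rw [seen_star_some, seen_star_some]
          simp
        rw [M.neighbourhood_congr hs]
        ext u
        by_cases hu : u = some j
        · subst hu
          simp [hj, hji, hq]
        · refine (Function.update_of_ne hu _ _).trans ?_
          simp [hu]
    obtain ⟨w, hw⟩ := key {j | f j = i} fun j hj => hj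
    refine ⟨w, ?_⟩
    rw [hw, succ_singleton]
    ext u
    obtain _ | j := u
    · simp
    · by_cases hj : f j = i
      · simp [hj, hq]
      · simp [hj]

theorem exists_word_star (M : Machine Λ 1) (f : κ → ι) (hf : Function.Surjective f)
    (C : M.Config (star ι hι lab)) (w : List (Option ι)) :
    ∃ w' : List (Option κ),
      M.exec (G := star κ hκ lab') (fun u => C (Option.map f u)) w' =
        fun u => M.exec C w (Option.map f u) := by
  induction w generalizing C with
  | nil => exact ⟨[], rfl⟩
  | cons v w ih =>
    obtain ⟨w₁, h₁⟩ := M.exists_word_succ_star (hκ := hκ) (lab' := lab') f hf C v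
    obtain ⟨w₂, h₂⟩ := ih (M.succ C {v})
    exact ⟨w₁ ++ w₂, by rw [exec_append, h₁, h₂]; rfl⟩

/-- The number of leaves of a star in each state. -/
noncomputable def leafCount (M : Machine Λ 1) (C : M.Config (star ι hι lab)) (q : M.Q) : ℕ :=
  Nat.card {i : ι // C (some i) = q}

theorem exists_surjective_of_leafCount_le (M : Machine Λ 1) (C : M.Config (star ι hι lab))
    (D : M.Config (star κ hκ lab')) (hle : ∀ q, M.leafCount C q ≤ M.leafCount D q)
    (h0 : ∀ q, M.leafCount C q = 0 → M.leafCount D q = 0) :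
    ∃ f : κ → ι, Function.Surjective f ∧ ∀ j, D (some j) = C (some (f j)) := by
  have h : ∀ q, ∃ g : {j : κ // D (some j) = q} → {i : ι // C (some i) = q},
      Function.Surjective g := by
    intro q
    obtain he | hne := isEmpty_or_nonempty {i : ι // C (some i) = q}
    · have : M.leafCount D q = 0 := h0 q (by simp [leafCount])
      have : IsEmpty {j : κ // D (some j) = q} := by
        rw [leafCount, Finite.card_eq_zero_iff] at this
        exact this
      exact ⟨fun j => isEmptyElim j, fun i => isEmptyElim i⟩
    · have := Fintype.ofFinite ι
      have := Fintype.ofFinite κ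
      classical
      obtain ⟨e⟩ : Nonempty ({i : ι // C (some i) = q} ↪ {j : κ // D (some j) = q}) := by
        rw [Function.Embedding.nonempty_iff_card_le, ← Nat.card_eq_fintype_card,
          ← Nat.card_eq_fintype_card]
        exact hle q
      exact ⟨Function.invFun e, Function.invFun_surjective e.injective⟩
  choose g hg using h
  refine ⟨fun j => (g (D (some j)) ⟨j, rfl⟩).1, fun i => ?_, fun j => (g _ ⟨j, rfl⟩).2.symm⟩
  obtain ⟨⟨j, hj⟩, hji⟩ := hg (C (some i)) ⟨i, rfl⟩
  refine ⟨j, ?_⟩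
  have : ∀ q (hq : D (some j) = q), (g q ⟨j, hq⟩).1 = (g (D (some j)) ⟨j, rfl⟩).1 := by
    rintro q rfl
    rfl
  dsimp only
  rw [← this _ hj, hji]

/-- The possibility of leaving `P` is inherited by stars with more leaves in the same states. -/
theorem Stable.of_leafCount_le {M : Machine Λ 1} {P : Set M.Q} {C : M.Config (star ι hι lab)}
    {D : M.Config (star κ hκ lab')} (hD : M.Stable P D) (hn : C none = D none)
    (hle : ∀ q, M.leafCount C q ≤ M.leafCount D q)
    (h0 : ∀ q, M.leafCount C q = 0 → M.leafCount D q = 0) : M.Stable P C := by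
  obtain ⟨f, hf, hfD⟩ := M.exists_surjective_of_leafCount_le C D hle h0
  have hDC : D = fun u => C (Option.map f u) := by
    ext u
    obtain _ | j := u
    · exact hn.symm
    · exact hfD j
  intro w v
  obtain ⟨w', hw'⟩ := M.exists_word_star (hκ := hκ) (lab' := lab') f hf C w
  obtain ⟨u, rfl⟩ : ∃ u, Option.map f u = v := by
    obtain _ | i := v
    · exact ⟨none, rfl⟩
    · obtain ⟨j, rfl⟩ := hf i
      exact ⟨some j, rfl⟩
  have := hD w' u
  rwa [hDC, hw'] at this

end Machine

/-- Dickson's lemma: membership in an upward closed set of vectors of natural numbers is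
witnessed below some bound. -/
theorem exists_min_mem_of_isUpperSet {Q : Type*} [Finite Q] {U : Set (Q → ℕ)} (hU : IsUpperSet U) :
    ∃ m : ℕ, ∀ n ∈ U, (fun q => min (n q) m) ∈ U := by
  by_contra! h
  choose n hn hnU using h
  obtain ⟨g, hg⟩ := (wellQuasiOrdered_le (α := Q → ℕ)).exists_monotone_subseq n
  obtain ⟨b, hb⟩ := (Set.finite_range (n (g 0))).bddAbove
  refine hnU (g b) (hU (fun q => le_min (hg 0 b (Nat.zero_le b) q) ?_) (hn (g 0)))
  exact (hb ⟨q, rfl⟩).trans (g.strictMono.le_apply)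

namespace Machine

variable {Λ : Type*}

/-- Stability of configurations of stars depends on the numbers of leaves up to a bound only. -/
theorem exists_bound_stable (M : Machine Λ 1) (P : Set M.Q) :
    ∃ m : ℕ, ∀ {ι κ : Type} [Finite ι] [Finite κ] {hι : 2 ≤ Nat.card ι} {hκ : 2 ≤ Nat.card κ}
      {lab : Option ι → Λ} {lab' : Option κ → Λ} (C : M.Config (star ι hι lab))
      (D : M.Config (star κ hκ lab')), C none = D none →
      (∀ q, min (M.leafCount D q) m ≤ M.leafCount C q) →
      (∀ q, M.leafCount D q = 0 → M.leafCount C q = 0) → M.Stable P C → M.Stable P D := by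
  classical
  -- `U q S` describes the unstable stars whose centre is in `q` and whose leaves occupy exactly
  -- the states of `S`; the shift by one makes it upward closed
  let U : M.Q → Set M.Q → Set (M.Q → ℕ) := fun q S => {n |
    ∃ (ι : Type) (_ : Finite ι) (hι : 2 ≤ Nat.card ι) (lab : Option ι → Λ)
      (C : M.Config (star ι hι lab)), C none = q ∧ (∀ r ∈ S, M.leafCount C r ≠ 0) ∧
      (∀ r, M.leafCount C r ≤ if r ∈ S then n r + 1 else 0) ∧ ¬ M.Stable P C}
  have hU : ∀ q S, IsUpperSet (U q S) := by
    rintro q S n n' hn ⟨ι, _, hι, lab, C, h1, h2, h3, h4⟩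
    refine ⟨ι, ‹_›, hι, lab, C, h1, h2, fun r => (h3 r).trans ?_, h4⟩
    split_ifs
    · exact Nat.succ_le_succ (hn r)
    · exact le_rfl
  choose b hb using fun x : M.Q × Set M.Q => exists_min_mem_of_isUpperSet (hU x.1 x.2)
  obtain ⟨m, hm⟩ := (Set.finite_range b).bddAbove
  refine ⟨m + 1, ?_⟩
  intro ι κ _ _ hι hκ lab lab' C D hn hle h0 hC
  by_contra hD
  set S : Set M.Q := {r | M.leafCount D r ≠ 0} with hS
  obtain ⟨ι', _, hι', lab₁, C', h1, h2, h3, h4⟩ := hb (D none, S) (fun r => M.leafCount D r - 1)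
    ⟨κ, ‹_›, hκ, lab', D, rfl, fun r hr => hr, fun r => by
      by_cases hr : M.leafCount D r = 0
      · simp [hr]
      · rw [if_pos (show r ∈ S from hr)]
        dsimp only
        omega, hD⟩
  refine h4 (hC.of_leafCount_le (h1.trans hn.symm) (fun r => ?_) fun r hr => ?_)
  · refine (h3 r).trans ?_
    have := hle r
    have hbm : b (D none, S) ≤ m := hm ⟨_, rfl⟩
    split_ifs with hr
    · have hr' : M.leafCount D r ≠ 0 := hr
      dsimp only
      omega
    · exact Nat.zero_le _
  · by_contra hr'
    exact h2 r (fun h => hr' (h0 r h)) hr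

end Machine
end DistAut

namespace DistAut

namespace Machine

variable {Λ : Type*} {β : ℕ}

/-- The initial configuration. -/
def start (M : Machine Λ β) (G : LGraph Λ) : M.Config G := fun v => M.init (G.label v)

/-- If `m` bounds the numbers of leaves that matter for stability, and `x` labels more leaves of a
star than `m` times the number of states, then the star with one more leaf labelled `x` behaves in
the same way: in the stable configuration some state is taken by more than `m` leaves labelled `x`,
and the additional leaf can imitate one of these. -/
theorem exists_word_stable_add_leaf (M : Machine Λ 1) {P : Set M.Q} {m : ℕ}
    (hm : ∀ {ι κ : Type} [Finite ι] [Finite κ] {hι : 2 ≤ Nat.card ι} {hκ : 2 ≤ Nat.card κ}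
      {lab : Option ι → Λ} {lab' : Option κ → Λ} (C : M.Config (star ι hι lab))
      (D : M.Config (star κ hκ lab')), C none = D none →
      (∀ q, min (M.leafCount D q) m ≤ M.leafCount C q) →
      (∀ q, M.leafCount D q = 0 → M.leafCount C q = 0) → M.Stable P C → M.Stable P D)
    {ι : Type} [Finite ι] {hι : 2 ≤ Nat.card ι} {hι' : 2 ≤ Nat.card (Option ι)} {c x : Λ}
    {ℓ : ι → Λ} (hx : m * Nat.card M.Q < Nat.card {i // ℓ i = x})
    (h : ∃ w, M.Stable P (M.exec (M.start (star ι hι fun u => u.elim c ℓ)) w)) :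
    ∃ w, M.Stable P
      (M.exec (M.start (star (Option ι) hι' fun u => u.elim c fun j => j.elim x ℓ)) w) := by
  obtain ⟨w, hw⟩ := h
  set C := M.exec (M.start (star ι hι fun u => u.elim c ℓ)) w with hC
  obtain ⟨q, hq⟩ : ∃ q, m < Nat.card {i : {i // ℓ i = x} // C (some i.1) = q} := by
    have := Fintype.ofFinite M.Q
    have := Fintype.ofFinite ι
    classical
    rw [Nat.card_eq_fintype_card, Nat.card_eq_fintype_card, mul_comm] at hx
    obtain ⟨q, hq⟩ := Fintype.exists_lt_card_fiber_of_mul_lt_card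
      (fun i : {i // ℓ i = x} => C (some i.1)) hx
    refine ⟨q, ?_⟩
    rwa [Nat.card_eq_fintype_card, Fintype.card_subtype]
  have hqm : m < M.leafCount C q := hq.trans_le <|
    Nat.card_le_card_of_injective (fun i => ⟨i.1.1, i.2⟩) fun i j hij => by
      simpa [Subtype.ext_iff] using hij
  have : 0 < Nat.card {i : {i // ℓ i = x} // C (some i.1) = q} := by omega
  obtain ⟨⟨⟨⟨i₀, hi₀⟩, hi₀q⟩⟩, -⟩ := Nat.card_pos_iff.1 this
  let f : Option ι → ι := fun j => j.elim i₀ id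
  have hf : Function.Surjective f := fun i => ⟨some i, rfl⟩
  obtain ⟨w', hw'⟩ := M.exists_word_star (hκ := hι')
    (lab' := fun u => u.elim c fun j => j.elim x ℓ) f hf
    (M.start (star ι hι fun u => u.elim c ℓ)) w
  have hstart : (fun u => M.start (star ι hι fun u => u.elim c ℓ) (Option.map f u)) =
      M.start (star (Option ι) hι' fun u => u.elim c fun j => j.elim x ℓ) := by
    ext u
    obtain _ | _ | i := u
    · rfl
    · exact congrArg M.init hi₀
    · rfl
  rw [hstart] at hw'
  refine ⟨w', ?_⟩
  refine hm (hι := hι) (lab := fun u => u.elim c ℓ) C _ ?_ (fun r => ?_) (fun r => ?_) hw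
  · rw [hw']
    rfl
  · rw [hw']
    by_cases hr : r = q
    · subst hr
      exact (min_le_right _ _).trans hqm.le
    · refine (min_le_left _ _).trans ?_
      refine Nat.card_le_card_of_surjective (fun i => ⟨some i.1, i.2⟩) ?_
      rintro ⟨_ | i, hi⟩
      · exact absurd (hi.symm.trans hi₀q) hr
      · exact ⟨⟨i, hi⟩, rfl⟩
  · rw [hw']
    intro h0
    rw [leafCount, Finite.card_eq_zero_iff] at h0 ⊢
    exact ⟨fun i => h0.false ⟨some i.1, i.2⟩⟩

end Machine

namespace Automaton

variable {Λ : Type*} {A : Automaton Λ 1}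

theorem mem_fair_iff {β : ℕ} {A : Automaton Λ β} (he : A.scheduler.Exclusive)
    (hp : A.scheduler.IsPseudoStochastic) {G : LGraph Λ} {σ : ℕ → Set G.V} :
    σ ∈ A.scheduler.fair G ↔ FairSchedule σ := by
  rw [hp G, he G]
  rfl

theorem not_accepting_and_rejecting {β : ℕ} {M : Machine Λ β} {G : LGraph Λ}
    {ρ : ℕ → M.Config G} (ha : M.AcceptingRun ρ) (hr : M.RejectingRun ρ) : False := by
  obtain ⟨t, ht⟩ := ha
  obtain ⟨s, hs⟩ := hr
  obtain ⟨v⟩ := G.connected.nonempty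
  exact Set.disjoint_left.1 M.disjoint (ht (max t s) (le_max_left _ _) v)
    (hs (max t s) (le_max_right _ _) v)

theorem accepts_iff_exists_stable {β : ℕ} {A : Automaton Λ β} (he : A.scheduler.Exclusive)
    (hp : A.scheduler.IsPseudoStochastic) (G : LGraph Λ) :
    A.Accepts G ↔ ∃ w, A.machine.Stable A.machine.Y (A.machine.exec (A.machine.start G) w) := by
  constructor
  · rintro ⟨σ, hσ, ha⟩
    rw [mem_fair_iff he hp] at hσ
    obtain ⟨t, ht⟩ := A.machine.exists_run_stable hσ ha
    obtain ⟨w, hw⟩ := A.machine.exists_word_run σ hσ t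
    exact ⟨w, hw ▸ ht⟩
  · rintro ⟨w, hw⟩
    obtain ⟨σ, hσ, ha⟩ := Machine.Stable.exists_fair_run hw
    exact ⟨σ, (mem_fair_iff he hp).2 hσ, ha⟩

theorem not_accepts_iff_exists_stable {β : ℕ} {A : Automaton Λ β} (he : A.scheduler.Exclusive)
    (hp : A.scheduler.IsPseudoStochastic) (G : LGraph Λ) :
    ¬ A.Accepts G ↔
      ∃ w, A.machine.Stable A.machine.N (A.machine.exec (A.machine.start G) w) := by
  constructor
  · intro h
    have := G.connected.nonempty
    obtain ⟨σ, hσ⟩ := exists_fairSchedule G.V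
    have hf := (mem_fair_iff he hp).2 hσ
    obtain ha | hr := A.consistent G
    · exact absurd ⟨σ, hf, ha σ hf⟩ h
    · obtain ⟨t, ht⟩ := A.machine.exists_run_stable hσ (hr σ hf)
      obtain ⟨w, hw⟩ := A.machine.exists_word_run σ hσ t
      exact ⟨w, hw ▸ ht⟩
  · rintro ⟨w, hw⟩ ⟨τ, hτ, ha⟩
    obtain ⟨σ, hσ, hr⟩ := Machine.Stable.exists_fair_run hw
    have hf := (mem_fair_iff he hp).2 hσ
    obtain ha' | hr' := A.consistent G
    · exact not_accepting_and_rejecting (ha' σ hf) hr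
    · exact not_accepting_and_rejecting ha (hr' τ hτ)

end Automaton

theorem exists_label_card_eq {Λ : Type*} [Finite Λ] (L : Λ → ℕ) :
    ∃ (ι : Type) (_ : Finite ι) (ℓ : ι → Λ), ∀ y, Nat.card {i // ℓ i = y} = L y := by
  obtain ⟨n, ⟨e⟩⟩ := Finite.exists_equiv_fin Λ
  refine ⟨Σ a : Fin n, Fin (L (e.symm a)), inferInstance, fun i => e.symm i.1, fun y => ?_⟩
  have : {i : Σ a : Fin n, Fin (L (e.symm a)) // e.symm i.1 = y} ≃ Fin (L y) :=
    { toFun := fun i => Fin.cast (by rw [i.2]) i.1.2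
      invFun := fun j => ⟨⟨e y, Fin.cast (by simp) j⟩, by simp⟩
      left_inv := by
        rintro ⟨⟨a, j⟩, rfl⟩
        simp only [Subtype.mk.injEq, Sigma.mk.injEq, Equiv.apply_symm_apply, true_and]
        rw [Fin.heq_ext_iff (by simp)]
        rfl
      right_inv := fun j => rfl }
  rw [Nat.card_congr this, Nat.card_fin]

open Classical in
theorem labelCount_star {Λ : Type*} {ι : Type} [Finite ι] {h : 2 ≤ Nat.card ι} {c : Λ} {ℓ : ι → Λ}
    (y : Λ) : (star ι h fun u => u.elim c ℓ).labelCount y =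
      Nat.card {i // ℓ i = y} + if y = c then 1 else 0 := by
  change Set.ncard {v : Option ι | v.elim c ℓ = y} = _
  have hsome : Set.ncard (some '' {i | ℓ i = y}) = Nat.card {i // ℓ i = y} := by
    rw [Set.ncard_image_of_injective _ (Option.some_injective _)]
    rfl
  split_ifs with hy
  · have : {v : Option ι | v.elim c ℓ = y} = insert none (some '' {i | ℓ i = y}) := by
      ext v
      obtain _ | i := v <;> simp [hy]
    rw [this, Set.ncard_insert_of_notMem (by simp), hsome]
  · have : {v : Option ι | v.elim c ℓ = y} = some '' {i | ℓ i = y} := by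
      ext v
      obtain _ | i := v <;> simp [Ne.symm hy]
    rw [this, hsome, add_zero]

open Classical in
/-- A property has a cutoff as soon as large entries can be increased by one. -/
theorem mem_Cutoff_of_update {Λ : Type*} [Finite Λ] {φ : (Λ → ℕ) → Prop} {K : ℕ}
    (h : ∀ L x, K ≤ L x → (φ L ↔ φ (Function.update L x (L x + 1)))) : φ ∈ Cutoff Λ := by
  refine ⟨K, ?_⟩
  have := Fintype.ofFinite Λ
  suffices ∀ n (L : Λ → ℕ), ∑ x, (L x - K) = n → (φ L ↔ φ (cutoff K L)) from
    fun L => this _ L rfl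
  intro n
  induction n with
  | zero =>
    intro L hL
    have : cutoff K L = L := by
      ext x
      have := Finset.sum_eq_zero_iff.1 hL x (Finset.mem_univ x)
      simp only [cutoff]
      omega
    rw [this]
  | succ n ih =>
    intro L hL
    obtain ⟨x, -, hx⟩ := Finset.exists_ne_zero_of_sum_ne_zero (by rw [hL]; omega)
    set L' := Function.update L x (L x - 1) with hL'
    have hup : Function.update L' x (L' x + 1) = L := by
      ext y
      by_cases hy : y = x
      · subst hy
        simp [hL']
        omega
      · simp [hL', hy]
    have hsum : ∑ y, (L' y - K) = n := by
      rw [← Finset.add_sum_erase _ _ (Finset.mem_univ x)] at hL ⊢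
      have : ∑ y ∈ Finset.univ.erase x, (L' y - K) = ∑ y ∈ Finset.univ.erase x, (L y - K) :=
        Finset.sum_congr rfl fun y hy => by simp [hL', Finset.ne_of_mem_erase hy]
      rw [this]
      simp only [hL', Function.update_self]
      omega
    have hcut : cutoff K L' = cutoff K L := by
      ext y
      by_cases hy : y = x
      · subst hy
        simp only [cutoff, hL', Function.update_self]
        omega
      · simp [cutoff, hL', hy]
    have := h L' x (by simp only [hL', Function.update_self]; omega)
    rw [hup] at this
    rw [← this, ih L' hsum, hcut]

/-- Automata of the class dAF decide only properties with a cutoff. -/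
theorem decidedByDAF_subset_Cutoff (Λ : Type*) [Finite Λ] : decidedByDAF Λ ⊆ Cutoff Λ := by
  classical
  rintro φ ⟨A, he, hp, hA⟩
  obtain ⟨m₁, h₁⟩ := A.machine.exists_bound_stable A.machine.Y
  obtain ⟨m₂, h₂⟩ := A.machine.exists_bound_stable A.machine.N
  set n := Nat.card A.machine.Q with hn
  -- one node labelled `x` is used up as the centre of the star
  refine mem_Cutoff_of_update (K := 3 + m₁ * n + m₂ * n) fun L x hx => ?_
  obtain ⟨ι, _, ℓ, hℓ⟩ := exists_label_card_eq (Function.update L x (L x - 1))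
  have hcard : Nat.card {i // ℓ i = x} = L x - 1 := by simp [hℓ]
  have hι : 2 ≤ Nat.card ι := by
    have := Nat.card_le_card_of_injective (fun i : {i // ℓ i = x} => i.1) Subtype.val_injective
    omega
  have hι' : 2 ≤ Nat.card (Option ι) := by
    rw [Finite.card_option]
    omega
  have hL : (star ι hι fun u => u.elim x ℓ).labelCount = L := by
    ext y
    rw [labelCount_star, hℓ]
    by_cases hy : y = x
    · subst hy
      simp
      omega
    · simp [hy]
  have hL' : (star (Option ι) hι' fun u => u.elim x fun j => j.elim x ℓ).labelCount =
      Function.update L x (L x + 1) := by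
    ext y
    have hopt : Nat.card {j : Option ι // j.elim x ℓ = y} =
        (star ι hι fun u => u.elim x ℓ).labelCount y := rfl
    rw [labelCount_star, hopt, hL]
    by_cases hy : y = x
    · subst hy
      simp
    · simp [hy]
  rw [← hL', ← hA]
  nth_rewrite 1 [← hL]
  rw [← hA]
  constructor
  · intro h
    rw [A.accepts_iff_exists_stable he hp] at h ⊢
    exact A.machine.exists_word_stable_add_leaf h₁ (by rw [← hn]; omega) h
  · intro h
    by_contra h'
    rw [A.not_accepts_iff_exists_stable he hp] at h'
    exact (A.not_accepts_iff_exists_stable he hp _).2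
      (A.machine.exists_word_stable_add_leaf h₂ (by rw [← hn]; omega) h') h

end DistAut

/-! ### A machine for thresholds -/

namespace DistAut

/-- The states of the threshold machine: a phase, i.e. a clock modulo three, a level, and the signal
that the node passed on in its last phase change (initially its own level). -/
@[ext] structure ThresholdState (k : ℕ) where
  phase : Fin 3
  level : Fin (k + 1)
  signal : Fin (k + 1)

namespace ThresholdState

variable {k : ℕ}

instance : Finite (ThresholdState k) :=
  Finite.of_injective (fun q => (q.phase, q.level, q.signal)) fun p q h => by
    simp only [Prod.mk.injEq] at h
    exact ThresholdState.ext h.1 h.2.1 h.2.2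

/-- The node moves on to the next phase and passes on the signal `s`, which lifts it by one level
if it is its own level. Level `0` belongs to the nodes that are not counted; signals do not lift
them. -/
def advance (q : ThresholdState k) (s : Fin (k + 1)) : ThresholdState k where
  phase := q.phase + 1
  level := if s = q.level ∧ q.level ≠ 0 then q.level + 1 else q.level
  signal := s

open Classical in
/-- The new state of a node in state `q` whose neighbours are in the states of `S`. The top level is
contagious. Otherwise, the node waits for neighbours that are one phase behind. If there are none,
it copies a signal from a neighbour that is one phase ahead, or, if there is none, it emits its own
level as a signal without being lifted itself. -/
noncomputable def next (q : ThresholdState k) (S : Set (ThresholdState k)) : ThresholdState k :=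
  if q.level = Fin.last k ∨ ∃ r ∈ S, r.level = Fin.last k then { q with level := Fin.last k }
  else if ∃ r ∈ S, r.phase + 1 = q.phase then q
  else if h : ∃ r ∈ S, r.phase = q.phase + 1 then q.advance h.choose.signal
  else { q with phase := q.phase + 1, signal := q.level }

theorem level_advance_le (q : ThresholdState k) (hq : q.level ≠ Fin.last k) (s : Fin (k + 1)) :
    q.level ≤ (q.advance s).level := by
  simp only [advance]
  split_ifs
  · exact (Fin.lt_add_one_iff.2 (Fin.lt_last_iff_ne_last.2 hq)).le
  · exact le_rfl

theorem level_le_next (q : ThresholdState k) (S : Set (ThresholdState k)) :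
    q.level ≤ (q.next S).level := by
  unfold next
  split_ifs with h1 h2 h3
  · exact Fin.le_last _
  · exact le_rfl
  · exact q.level_advance_le (fun h => h1 (Or.inl h)) _
  · exact le_rfl

end ThresholdState

open Classical in
/-- The machine that decides whether at least `k` nodes are labelled `x`. -/
@[reducible] noncomputable def thresholdMachine {Λ : Type*} (x : Λ) (k : ℕ) : Machine Λ 1 where
  Q := ThresholdState k
  finite := inferInstance
  init := fun y => ⟨0, if y = x then 1 else 0, if y = x then 1 else 0⟩
  δ := fun q n => q.next {r | n r ≠ 0}
  Y := {q | q.level = Fin.last k}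
  N := {q | q.level ≠ Fin.last k}
  disjoint := Set.disjoint_left.2 fun _ h h' => h' h

namespace thresholdMachine

variable {Λ : Type*} {x : Λ} {k : ℕ} {G : LGraph Λ}

theorem succ_singleton [DecidableEq G.V] (C : (thresholdMachine x k).Config G) (v : G.V) :
    (thresholdMachine x k).succ C {v} =
      Function.update C v ((C v).next ((thresholdMachine x k).seen C v)) := by
  classical
  have hs : {r | (thresholdMachine x k).neighbourhood C v r ≠ 0} =
      (thresholdMachine x k).seen C v := by
    ext r
    rw [Set.mem_ofPred_eq, Machine.neighbourhood_apply]
    split_ifs with h <;> simp [h]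
  rw [Machine.succ_singleton, ← hs]

theorem level_le_succ (C : (thresholdMachine x k).Config G) (v u : G.V) :
    (C u).level ≤ ((thresholdMachine x k).succ C {v} u).level := by
  classical
  rw [succ_singleton]
  by_cases hu : u = v
  · subst hu
    rw [Function.update_self]
    exact ThresholdState.level_le_next _ _
  · rw [Function.update_of_ne hu]

theorem level_le_exec (C : (thresholdMachine x k).Config G) (w : List G.V) (u : G.V) :
    (C u).level ≤ ((thresholdMachine x k).exec C w u).level := by
  induction w generalizing C with
  | nil => exact le_rfl
  | cons v w ih => exact (level_le_succ C v u).trans (ih _)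

/-- The invariant as long as no node is on the top level. The phases are the residues of clocks
`c` that differ by at most one between neighbours; every signal `s` passed on at time `c v` is backed
by a node that is now on level `s` and whose clock is not behind `c v`; the occupied levels have no
gaps; and exactly the nodes labelled `x` have a positive level. -/
structure Good (C : (thresholdMachine x k).Config G) (c : G.V → ℕ) : Prop where
  phase : ∀ v, ((C v).phase : ℕ) = c v % 3
  clock : ∀ u v, G.graph.Adj u v → c u ≤ c v + 1
  signal : ∀ v, ∃ w, (C w).level = (C v).signal ∧ c v ≤ c w
  level : ∀ v i, ((C v).level : ℕ) = i + 2 → ∃ u, ((C u).level : ℕ) = i + 1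
  label : ∀ v, (C v).level ≠ 0 ↔ G.label v = x

theorem phase_succ {n : ℕ} {p : Fin 3} (h : (p : ℕ) = n % 3) :
    ((p + 1 : Fin 3) : ℕ) = (n + 1) % 3 := by
  rw [Fin.val_add, h]
  simp

/-- How a node changes its state as long as no node is on the top level: if a neighbour is behind,
then it waits; if a neighbour is ahead, it copies the signal of some such neighbour; and otherwise it
emits its own level. -/
theorem Good.next_eq {C : (thresholdMachine x k).Config G} {c : G.V → ℕ} (h : Good C c)
    (hl : ∀ v, (C v).level ≠ Fin.last k) (v : G.V) :
    ((∃ u, G.graph.Adj v u ∧ c u < c v) ∧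
      (C v).next ((thresholdMachine x k).seen C v) = C v) ∨
    ((∀ u, G.graph.Adj v u → c v ≤ c u) ∧ ∃ u, G.graph.Adj v u ∧ c u = c v + 1 ∧
      (C v).next ((thresholdMachine x k).seen C v) = (C v).advance (C u).signal) ∨
    ((∀ u, G.graph.Adj v u → c u = c v) ∧ (C v).next ((thresholdMachine x k).seen C v) =
      { C v with phase := (C v).phase + 1, signal := (C v).level }) := by
  have hclock : ∀ u, G.graph.Adj v u → c u ≤ c v + 1 ∧ c v ≤ c u + 1 := fun u hu =>
    ⟨h.clock u v hu.symm, h.clock v u hu⟩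
  have hbehind : ∀ u, G.graph.Adj v u → ((C u).phase + 1 = (C v).phase ↔ c u < c v) := by
    intro u hu
    have := hclock u hu
    rw [Fin.ext_iff, phase_succ (h.phase u), h.phase v]
    omega
  have hahead : ∀ u, G.graph.Adj v u → ((C u).phase = (C v).phase + 1 ↔ c u = c v + 1) := by
    intro u hu
    have := hclock u hu
    rw [Fin.ext_iff, phase_succ (h.phase v), h.phase u]
    omega
  have h1 : ¬ ((C v).level = Fin.last k ∨
      ∃ r ∈ (thresholdMachine x k).seen C v, r.level = Fin.last k) := by
    rintro (h1 | ⟨r, ⟨u, -, rfl⟩, hr⟩)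
    · exact hl _ h1
    · exact hl _ hr
  unfold ThresholdState.next
  rw [if_neg h1]
  split_ifs with h2 h3
  · obtain ⟨r, ⟨u, hu, rfl⟩, hr⟩ := h2
    exact Or.inl ⟨⟨u, hu, (hbehind u hu).1 hr⟩, rfl⟩
  · have hle : ∀ u, G.graph.Adj v u → c v ≤ c u := fun u hu => by
      by_contra hlt
      exact h2 ⟨_, ⟨u, hu, rfl⟩, (hbehind u hu).2 (not_le.1 hlt)⟩
    obtain ⟨⟨u, hu, hur⟩, hr⟩ := h3.choose_spec
    refine Or.inr (Or.inl ⟨hle, u, hu, (hahead u hu).1 ?_, ?_⟩)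
    · rw [hur, hr]
    · rw [hur]
  · refine Or.inr (Or.inr ⟨fun u hu => ?_, rfl⟩)
    have hb : ¬ c u < c v := fun hlt => h2 ⟨_, ⟨u, hu, rfl⟩, (hbehind u hu).2 hlt⟩
    have ha : ¬ c u = c v + 1 := fun heq => h3 ⟨_, ⟨u, hu, rfl⟩, (hahead u hu).2 heq⟩
    have := hclock u hu
    omega

/-- The clock of a node that moves on. -/
theorem clock_update [DecidableEq G.V] {c : G.V → ℕ}
    (hc : ∀ u v, G.graph.Adj u v → c u ≤ c v + 1) {v : G.V}
    (hv : ∀ u, G.graph.Adj v u → c v ≤ c u) (u u' : G.V) (h : G.graph.Adj u u') :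
    Function.update c v (c v + 1) u ≤ Function.update c v (c v + 1) u' + 1 := by
  have := hc u u' h
  by_cases hu : u = v
  · subst hu
    rw [Function.update_self, Function.update_of_ne h.ne']
    have := hv u' h
    omega
  · rw [Function.update_of_ne hu]
    by_cases hu' : u' = v
    · subst hu'
      rw [Function.update_self]
      omega
    · rwa [Function.update_of_ne hu']

theorem Good.succ_wait {C : (thresholdMachine x k).Config G} {c : G.V → ℕ} (h : Good C c)
    (hl : ∀ v, (C v).level ≠ Fin.last k) {v : G.V} (hv : ∃ u, G.graph.Adj v u ∧ c u < c v) :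
    (thresholdMachine x k).succ C {v} = C := by
  classical
  obtain ⟨u, hu, huv⟩ := hv
  rw [succ_singleton]
  obtain ⟨-, h'⟩ | ⟨h', -⟩ | ⟨h', -⟩ := h.next_eq hl v
  · rw [h', Function.update_eq_self]
  · have := h' u hu
    omega
  · have := h' u hu
    omega

theorem Good.succ_move [DecidableEq G.V] {C : (thresholdMachine x k).Config G} {c : G.V → ℕ}
    (h : Good C c) (hl : ∀ v, (C v).level ≠ Fin.last k) {v : G.V}
    (hv : ∀ u, G.graph.Adj v u → c v ≤ c u) :
    Good ((thresholdMachine x k).succ C {v}) (Function.update c v (c v + 1)) := by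
  rw [succ_singleton]
  -- the case that `v` is not lifted
  have hmain : ∀ q : ThresholdState k, q.phase = (C v).phase + 1 → q.level = (C v).level →
      (∃ w, (C w).level = q.signal ∧ (w = v ∨ c v + 1 ≤ c w)) →
      Good (Function.update C v q) (Function.update c v (c v + 1)) := by
    intro q h1 h2 h3
    have hlev : ∀ u, (Function.update C v q u).level = (C u).level := by
      intro u
      by_cases hu : u = v
      · subst hu
        rw [Function.update_self, h2]
      · rw [Function.update_of_ne hu]
    have hcle : ∀ u, c u ≤ Function.update c v (c v + 1) u := by
      intro u
      by_cases hu : u = v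
      · subst hu
        simp
      · rw [Function.update_of_ne hu]
    refine ⟨fun u => ?_, clock_update h.clock hv, fun u => ?_, fun u i hi => ?_, fun u => ?_⟩
    · by_cases hu : u = v
      · subst hu
        rw [Function.update_self, Function.update_self, h1, phase_succ (h.phase u)]
      · rw [Function.update_of_ne hu, Function.update_of_ne hu, h.phase]
    · by_cases hu : u = v
      · subst hu
        rw [Function.update_self, Function.update_self]
        obtain ⟨w, hw, hcw⟩ := h3
        refine ⟨w, (hlev w).trans hw, ?_⟩
        obtain rfl | hcw := hcw
        · simp
        · exact hcw.trans (hcle w)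
      · rw [Function.update_of_ne hu, Function.update_of_ne hu]
        obtain ⟨w, hw, hcw⟩ := h.signal u
        exact ⟨w, (hlev w).trans hw, hcw.trans (hcle w)⟩
    · rw [hlev] at hi
      obtain ⟨w, hw⟩ := h.level u i hi
      exact ⟨w, by rw [hlev, hw]⟩
    · rw [hlev, h.label]
  obtain ⟨⟨u, hu, huv⟩, -⟩ | ⟨-, u, hu, hcu, hq⟩ | ⟨-, hq⟩ := h.next_eq hl v
  · have := hv u hu
    omega
  · rw [hq]
    obtain ⟨w, hw, hcw⟩ := h.signal u
    by_cases hs : (C u).signal = (C v).level ∧ (C v).level ≠ 0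
    swap
    · exact hmain _ rfl (if_neg hs) ⟨w, hw, Or.inr (by omega)⟩
    -- the node is lifted, and `w` takes over its duties on the level that it leaves
    have hwv : w ≠ v := by
      rintro rfl
      omega
    set q := (C v).advance (C u).signal with hqdef
    have hqlev : q.level = (C v).level + 1 := if_pos hs
    have hqval : (q.level : ℕ) = (C v).level + 1 := by
      rw [hqlev, Fin.val_add_one_of_lt (Fin.lt_last_iff_ne_last.2 (hl v))]
    have hwl : (C w).level = (C v).level := hw.trans hs.1
    have htake : ∀ i (t : ℕ), t ≤ c v + 1 → (∃ z, (C z).level = i ∧ t ≤ c z) →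
        ∃ z, (Function.update C v q z).level = i ∧ t ≤ Function.update c v (c v + 1) z := by
      rintro i t ht ⟨z, hz, htz⟩
      by_cases hzv : z = v
      · refine ⟨w, ?_, ?_⟩
        · rw [Function.update_of_ne hwv, hwl, ← hz, hzv]
        · rw [Function.update_of_ne hwv]
          omega
      · exact ⟨z, by rw [Function.update_of_ne hzv, hz], by rwa [Function.update_of_ne hzv]⟩
    refine ⟨fun y => ?_, clock_update h.clock hv, fun y => ?_, fun y i hi => ?_, fun y => ?_⟩
    · by_cases hy : y = v
      · subst hy
        rw [Function.update_self, Function.update_self, hqdef]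
        exact phase_succ (h.phase y)
      · rw [Function.update_of_ne hy, Function.update_of_ne hy, h.phase]
    · by_cases hy : y = v
      · subst hy
        rw [Function.update_self, Function.update_self]
        exact htake _ _ le_rfl ⟨w, hw, by omega⟩
      · rw [Function.update_of_ne hy, Function.update_of_ne hy]
        obtain ⟨z, hz, hcz⟩ := h.signal y
        by_cases hzv : z = v
        · exact htake _ _ (by rw [hzv] at hcz; omega) ⟨z, hz, hcz⟩
        · exact ⟨z, by rw [Function.update_of_ne hzv, hz], by rwa [Function.update_of_ne hzv]⟩
    · have : ∃ z, ((C z).level : ℕ) = i + 1 := by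
        by_cases hy : y = v
        · subst hy
          rw [Function.update_self, hqval] at hi
          exact ⟨y, by omega⟩
        · rw [Function.update_of_ne hy] at hi
          exact h.level y i hi
      obtain ⟨z, hz⟩ := this
      obtain ⟨z', hz', -⟩ := htake (C z).level 0 (Nat.zero_le _) ⟨z, rfl, Nat.zero_le _⟩
      exact ⟨z', by rw [hz', hz]⟩
    · by_cases hy : y = v
      · subst hy
        rw [Function.update_self, ← h.label]
        refine iff_of_true (fun h0 => ?_) hs.2
        rw [h0] at hqval
        simp at hqval
      · rw [Function.update_of_ne hy, h.label]
  · rw [hq]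
    exact hmain _ rfl rfl ⟨v, rfl, Or.inl rfl⟩

theorem Good.exists_succ {C : (thresholdMachine x k).Config G} {c : G.V → ℕ}
    (h : Good C c) (hl : ∀ v, (C v).level ≠ Fin.last k) (v : G.V) :
    ∃ c', Good ((thresholdMachine x k).succ C {v}) c' := by
  classical
  by_cases hv : ∃ u, G.graph.Adj v u ∧ c u < c v
  · exact ⟨c, by rwa [h.succ_wait hl hv]⟩
  · push Not at hv
    exact ⟨_, h.succ_move hl hv⟩

theorem good_start (hk : k ≠ 0) : Good ((thresholdMachine x k).start G) 0 where
  phase v := rfl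
  clock := by simp
  signal v := ⟨v, rfl, le_rfl⟩
  level v i hi := by
    exfalso
    have h1 : ((1 : Fin (k + 1)) : ℕ) = 1 := by
      rw [Fin.val_one']
      exact Nat.mod_eq_of_lt (by omega)
    simp only [Machine.start] at hi
    split_ifs at hi
    · omega
    · simp at hi
  label v := by
    have h1 : (1 : Fin (k + 1)) ≠ 0 := by
      simp [hk]
    simp only [Machine.start]
    split_ifs with h <;> simp [h, h1]

/-- Since the occupied levels have no gaps, the levels do not exceed the number of nodes labelled
`x`. -/
theorem Good.level_le {C : (thresholdMachine x k).Config G} {c : G.V → ℕ} (h : Good C c)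
    (v : G.V) : ((C v).level : ℕ) ≤ G.labelCount x := by
  have hdown : ∀ d i : ℕ, (∃ u, ((C u).level : ℕ) = i + 1 + d) → ∃ u, ((C u).level : ℕ) = i + 1 := by
    intro d
    induction d with
    | zero => exact fun i h => h
    | succ d ih =>
      rintro i ⟨u, hu⟩
      exact ih i (h.level u (i + d) (by omega) |>.imp fun _ h => by omega)
  have hsub : (Finset.range ((C v).level : ℕ) : Set ℕ) ⊆
      (fun u => ((C u).level : ℕ) - 1) '' {u | G.label u = x} := by
    intro i hi
    have hi : i < (C v).level := by simpa using hi
    obtain ⟨u, hu⟩ := hdown ((C v).level - (i + 1)) i ⟨v, by omega⟩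
    refine ⟨u, (h.label u).1 fun h0 => ?_, ?_⟩
    · rw [h0] at hu
      simp at hu
    · simp only [hu]
      omega
  have := (Set.ncard_le_ncard hsub (Set.toFinite _)).trans (Set.ncard_image_le (Set.toFinite _))
  rwa [Set.ncard_coe_finset, Finset.card_range] at this

end thresholdMachine
end DistAut

namespace DistAut

theorem LGraph.exists_adj_mem_notMem {Λ : Type*} (G : LGraph Λ) {A : Set G.V} {u w : G.V}
    (hu : u ∈ A) (hw : w ∉ A) : ∃ a ∈ A, ∃ b ∉ A, G.graph.Adj b a := by
  obtain ⟨p⟩ := G.connected.preconnected u w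
  obtain ⟨d, -, h1, h2⟩ := p.exists_boundary_dart A hu hw
  exact ⟨d.fst, h1, d.snd, h2, d.adj.symm⟩

namespace thresholdMachine

variable {Λ : Type*} {x : Λ} {k : ℕ} {G : LGraph Λ}

/-- Unless levels change on the way, all clocks can be brought to the same value, by always
selecting a node that is furthest behind. -/
theorem Good.exists_word_clock_const {C : (thresholdMachine x k).Config G} {c : G.V → ℕ}
    (h : Good C c) (hl : ∀ v, (C v).level ≠ Fin.last k)
    (hstay : ∀ w v, ((thresholdMachine x k).exec C w v).level = (C v).level) :
    ∃ w t, Good ((thresholdMachine x k).exec C w) fun _ => t := by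
  classical
  have := Fintype.ofFinite G.V
  obtain ⟨M, hM⟩ := (Set.finite_range c).bddAbove
  replace hM : ∀ v, c v ≤ M := fun v => hM ⟨v, rfl⟩
  generalize hn : ∑ v, (M - c v) = n
  induction n generalizing C c with
  | zero =>
    have hc : c = fun _ => M := by
      ext v
      have := Finset.sum_eq_zero_iff.1 hn v (Finset.mem_univ v)
      have := hM v
      omega
    rw [hc] at h
    exact ⟨[], M, h⟩
  | succ n ih =>
    have := G.connected.nonempty
    obtain ⟨v, hv⟩ := Finite.exists_min c
    have hvM : c v < M := by
      obtain ⟨u, -, hu⟩ := Finset.exists_ne_zero_of_sum_ne_zero (by rw [hn]; omega)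
      have := hv u
      omega
    have hlev := hstay [v]
    simp only [Machine.exec_cons, Machine.exec_nil] at hlev
    obtain ⟨w, t, hw⟩ := ih (h.succ_move hl fun u _ => hv u) (fun u => by rw [hlev]; exact hl u)
      (fun w u => (hstay (v :: w) u).trans (hlev u).symm)
      (fun u => by
        by_cases hu : u = v
        · subst hu
          rw [Function.update_self]
          omega
        · rw [Function.update_of_ne hu]
          exact hM u)
      (by
        rw [← Finset.add_sum_erase _ _ (Finset.mem_univ v)] at hn ⊢
        have : ∑ u ∈ Finset.univ.erase v, (M - Function.update c v (c v + 1) u) =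
            ∑ u ∈ Finset.univ.erase v, (M - c u) :=
          Finset.sum_congr rfl fun u hu => by rw [Function.update_of_ne (Finset.ne_of_mem_erase hu)]
        rw [this, Function.update_self]
        omega)
    exact ⟨v :: w, t, hw⟩

/-- If two nodes share a positive level, then some level can be changed: when all clocks agree, let
one of the two nodes emit its level as a signal, and let the signal spread until it meets another
node of this level. -/
theorem Good.exists_word_level_ne {C : (thresholdMachine x k).Config G} {t : ℕ}
    (h : Good C fun _ => t) (hl : ∀ v, (C v).level ≠ Fin.last k) {u w : G.V} (huw : u ≠ w)
    (heq : (C u).level = (C w).level) (h0 : (C u).level ≠ 0) :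
    ∃ W z, ((thresholdMachine x k).exec C W z).level ≠ (C z).level := by
  classical
  by_contra! hstay
  -- `A` is the region that the signal has reached
  let P : Set G.V → Prop := fun A => u ∈ A ∧ w ∉ A ∧ ∃ W c,
    Good ((thresholdMachine x k).exec C W) c ∧
      (∀ v ∈ A, c v = t + 1 ∧ ((thresholdMachine x k).exec C W v).signal = (C u).level) ∧
      ∀ v ∉ A, c v = t
  have hP : P {u} := by
    refine ⟨rfl, huw.symm, [u], _, h.succ_move hl fun _ _ => le_rfl, ?_, ?_⟩
    · rintro v rfl
      refine ⟨Function.update_self .., ?_⟩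
      rw [Machine.exec_cons, Machine.exec_nil, succ_singleton, Function.update_self]
      obtain ⟨⟨_, -, hlt⟩, -⟩ | ⟨-, _, -, hlt, -⟩ | ⟨-, hq⟩ := h.next_eq hl v
      · exact absurd hlt (lt_irrefl _)
      · omega
      · rw [hq]
    · intro v hv
      exact Function.update_of_ne hv _ _
  obtain ⟨A, ⟨huA, hwA, W, c, hg, hA, hA'⟩, hmax⟩ := (Set.toFinite {A | P A}).exists_maximal ⟨_, hP⟩
  obtain ⟨a, ha, v, hv, hva⟩ := G.exists_adj_mem_notMem huA hwA
  set D := (thresholdMachine x k).exec C W with hD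
  have hDl : ∀ z, (D z).level = (C z).level := hstay W
  have hlD : ∀ z, (D z).level ≠ Fin.last k := fun z => by rw [hDl]; exact hl z
  have hcv : c v = t := hA' v hv
  have hle : ∀ z, c v ≤ c z := fun z => by
    by_cases hz : z ∈ A
    · have := (hA z hz).1
      omega
    · have := hA' z hz
      omega
  have hsucc : (thresholdMachine x k).exec C (W ++ [v]) = (thresholdMachine x k).succ D {v} := by
    rw [Machine.exec_append]
    rfl
  have hself : (thresholdMachine x k).exec C (W ++ [v]) v = (D v).advance (C u).level := by
    rw [hsucc, succ_singleton, Function.update_self]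
    obtain ⟨⟨z, -, hlt⟩, -⟩ | ⟨-, z, -, hz, hq⟩ | ⟨hz, -⟩ := hg.next_eq hlD v
    · have := hle z
      omega
    · have hzA : z ∈ A := by
        by_contra hzA
        have := hA' z hzA
        omega
      rw [hq, (hA z hzA).2]
    · have := hz a hva
      have := (hA a ha).1
      omega
  have hvw : v ≠ w := by
    rintro rfl
    have h1 := hstay (W ++ [v]) v
    rw [hself, ThresholdState.advance, if_pos (by rw [hDl, ← heq]; exact ⟨rfl, h0⟩), hDl] at h1
    have h2 := Fin.val_add_one_of_lt (Fin.lt_last_iff_ne_last.2 (hl v))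
    change (C v).level + 1 = (C v).level at h1
    rw [h1] at h2
    omega
  have hPv : P (insert v A) := by
    refine ⟨Set.mem_insert_of_mem _ huA, ?_, W ++ [v], Function.update c v (c v + 1), ?_, ?_, ?_⟩
    · rintro (hwv | hwA')
      exacts [hvw hwv.symm, hwA hwA']
    · rw [hsucc]
      exact hg.succ_move hlD fun z _ => hle z
    · intro z hz
      by_cases hzv : z = v
      · subst hzv
        rw [Function.update_self, hself, hcv]
        exact ⟨rfl, rfl⟩
      · rw [hsucc, succ_singleton, Function.update_of_ne hzv, Function.update_of_ne hzv]
        exact hA z (hz.resolve_left hzv)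
    · intro z hz
      rw [Function.update_of_ne fun hzv => hz (Or.inl hzv)]
      exact hA' z fun hzA => hz (Or.inr hzA)
  exact hv (hmax hPv (Set.subset_insert _ _) (Set.mem_insert _ _))

variable (x k G) in
/-- The configurations in which the top level has been reached or the invariant holds. -/
def valid : Set ((thresholdMachine x k).Config G) :=
  {C | (∃ v, (C v).level = Fin.last k) ∨ ∃ c, Good C c}

theorem succ_mem_valid {C : (thresholdMachine x k).Config G} (hC : C ∈ valid x k G) (v : G.V) :
    (thresholdMachine x k).succ C {v} ∈ valid x k G := by
  by_cases hl : ∃ v, (C v).level = Fin.last k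
  · obtain ⟨u, hu⟩ := hl
    exact Or.inl ⟨u, Fin.last_le_iff.1 (hu ▸ level_le_succ C v u)⟩
  · obtain ⟨c, hc⟩ := hC.resolve_left hl
    push Not at hl
    exact Or.inr (hc.exists_succ hl v)

theorem exists_word_level_ne (hk : k ≠ 0) (hx : k ≤ G.labelCount x)
    {C : (thresholdMachine x k).Config G} (hC : C ∈ valid x k G)
    (hlast : ¬ ∀ v, (C v).level = Fin.last k) :
    ∃ W z, ((thresholdMachine x k).exec C W z).level ≠ (C z).level := by
  classical
  by_cases hl : ∃ v, (C v).level = Fin.last k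
  · push Not at hlast
    obtain ⟨u, hu⟩ := hl
    obtain ⟨w, hw⟩ := hlast
    obtain ⟨a, ha, v, hv, hva⟩ :=
      G.exists_adj_mem_notMem (A := {v | (C v).level = Fin.last k}) hu hw
    refine ⟨[v], v, ?_⟩
    rw [Machine.exec_cons, Machine.exec_nil, succ_singleton, Function.update_self,
      ThresholdState.next, if_pos (Or.inr ⟨_, ⟨a, hva, rfl⟩, ha⟩)]
    exact fun h => hv h.symm
  · obtain ⟨c, hc⟩ := hC.resolve_left hl
    push Not at hl
    by_contra! hstay
    obtain ⟨W, t, hg⟩ := hc.exists_word_clock_const hl hstay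
    set D := (thresholdMachine x k).exec C W with hD
    have hDl : ∀ z, (D z).level = (C z).level := hstay W
    have hlD : ∀ z, (D z).level ≠ Fin.last k := fun z => by rw [hDl]; exact hl z
    -- at least `k` nodes share the `k - 1` levels between `0` and the top
    obtain ⟨u, hu, w, -, huw, heq⟩ := Set.exists_ne_map_eq_of_ncard_lt_of_maps_to
      (s := {v | G.label v = x}) (t := (Finset.Ico 1 k : Set ℕ))
      (f := fun v => ((D v).level : ℕ))
      (by
        rw [Set.ncard_coe_finset, Nat.card_Ico]
        exact lt_of_lt_of_le (by omega) hx)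
      (by
        intro v hv
        have h1 := (hg.label v).2 hv
        have h2 := Fin.lt_last_iff_ne_last.2 (hlD v)
        rw [Fin.lt_def, Fin.val_last] at h2
        rw [Ne, Fin.ext_iff, Fin.val_zero] at h1
        simp only [Finset.coe_Ico, Set.mem_Ico]
        omega)
    obtain ⟨W', z, hz⟩ := hg.exists_word_level_ne hlD huw (Fin.ext heq) ((hg.label u).2 hu)
    rw [hD, ← Machine.exec_append, ← hD, hDl] at hz
    exact hz (hstay _ z)

theorem exists_word_level_eq_last (hk : k ≠ 0) (hx : k ≤ G.labelCount x)
    {C : (thresholdMachine x k).Config G} (hC : C ∈ valid x k G) :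
    ∃ W, ∀ v, ((thresholdMachine x k).exec C W v).level = Fin.last k := by
  generalize hL : (fun v => (C v).level) = L
  induction L using WellFoundedGT.induction generalizing C with
  | ind L ih =>
    by_cases hlast : ∀ v, (C v).level = Fin.last k
    · exact ⟨[], hlast⟩
    obtain ⟨W, z, hz⟩ := exists_word_level_ne hk hx hC hlast
    have hlt : L < fun v => ((thresholdMachine x k).exec C W v).level := by
      subst hL
      refine lt_of_le_of_ne (fun v => level_le_exec C W v) fun h => hz ?_
      exact (congrFun h z).symm
    obtain ⟨W', hW'⟩ := ih _ hlt (Machine.exec_mem _ (fun _ h v => succ_mem_valid h v) hC W) rfl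
    exact ⟨W ++ W', fun v => by rw [Machine.exec_append, hW']⟩

theorem acceptingRun (hk : k ≠ 0) (hx : k ≤ G.labelCount x) {σ : ℕ → Set G.V}
    (hσ : FairSchedule σ) :
    (thresholdMachine x k).AcceptingRun ((thresholdMachine x k).run G σ) := by
  have hfreq := (thresholdMachine x k).frequently_run_mem (fun _ h v => succ_mem_valid h v)
    (T := {C : (thresholdMachine x k).Config G | ∀ v, (C v).level = Fin.last k})
    (fun C hC => exists_word_level_eq_last hk hx hC) hσ (Or.inr ⟨_, good_start hk⟩)
  obtain ⟨t, ht⟩ := hfreq.exists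
  refine ⟨t, fun t' ht' => (Machine.run_mem _ ?_ hσ ht ht' : _ ∈ {C | ∀ v, _})⟩
  intro C hC v u
  exact Fin.last_le_iff.1 (hC u ▸ level_le_succ C v u)

theorem rejectingRun (hx : G.labelCount x < k) {σ : ℕ → Set G.V} (hσ : FairSchedule σ) :
    (thresholdMachine x k).RejectingRun ((thresholdMachine x k).run G σ) := by
  have hne : ∀ {C : (thresholdMachine x k).Config G}, (∃ c, Good C c) →
      ∀ v, (C v).level ≠ Fin.last k := by
    rintro C ⟨c, hc⟩ v hv
    have := hc.level_le v
    rw [hv, Fin.val_last] at this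
    omega
  refine ⟨0, fun t _ v => hne (Machine.run_mem _ (I := {C | ∃ c, Good C c}) ?_ hσ
    (t := 0) ⟨_, good_start (by omega)⟩ (Nat.zero_le t)) v⟩
  rintro C ⟨c, hc⟩ v
  exact hc.exists_succ (hne ⟨c, hc⟩) v

end thresholdMachine

/-! ### Boolean combinations -/

open Classical in
/-- Several non-counting machines run side by side under the same schedule; `Y` is the set of
accepting states of the product, and all other states are rejecting. -/
@[reducible] noncomputable def prodMachine {Λ : Type*} {ι : Type} [Finite ι] (M : ι → Machine Λ 1)
    (Y : Set (∀ i, (M i).Q)) : Machine Λ 1 where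
  Q := ∀ i, (M i).Q
  finite := inferInstance
  init := fun y i => (M i).init y
  δ := fun q n i => (M i).δ (q i) fun r => if ∃ p, p i = r ∧ n p ≠ 0 then 1 else 0
  Y := Y
  N := Yᶜ
  disjoint := disjoint_compl_right

theorem prodMachine_run {Λ : Type*} {ι : Type} [Finite ι] (M : ι → Machine Λ 1)
    (Y : Set (∀ i, (M i).Q)) {G : LGraph Λ} (σ : ℕ → Set G.V) (t : ℕ) (v : G.V) (i : ι) :
    (prodMachine M Y).run G σ t v i = (M i).run G σ t v := by
  classical
  induction t generalizing v with
  | zero => rfl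
  | succ t ih =>
    simp only [Machine.run, Machine.succ]
    by_cases hv : v ∈ σ t
    · rw [if_pos hv, if_pos hv]
      rw [ih]
      congr 1
      ext1 r
      rw [Machine.neighbourhood_apply]
      refine if_congr ?_ rfl rfl
      have hne : ∀ p, (prodMachine M Y).neighbourhood ((prodMachine M Y).run G σ t) v p ≠ 0 ↔
          p ∈ (prodMachine M Y).seen ((prodMachine M Y).run G σ t) v := by
        intro p
        rw [Machine.neighbourhood_apply]
        split_ifs with h <;> simp [h]
      constructor
      · rintro ⟨p, rfl, hp⟩
        obtain ⟨u, hu, rfl⟩ := (hne p).1 hp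
        exact ⟨u, hu, (ih u).symm⟩
      · rintro ⟨u, hu, rfl⟩
        exact ⟨_, ih u, (hne _).2 ⟨u, hu, rfl⟩⟩
    · rw [if_neg hv, if_neg hv, ih]

/-- Exclusive selection with pseudo-stochastic fairness. -/
def exclusiveScheduler (Λ : Type*) : Scheduler Λ where
  permitted G := Set.range fun v : G.V => ({v} : Set G.V)
  covers _ v := ⟨{v}, ⟨v, rfl⟩, rfl⟩
  fair _ := {σ | FairSchedule σ}
  fair_permitted _ _ hσ := hσ.1
  fair_schedule _ _ hσ v := (hσ.frequently_word [v]).mono fun t ht => by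
    have := ht 0 (by simp)
    rw [add_zero] at this
    rw [this]
    rfl

/-- Every property with a cutoff is decided by an automaton of the class dAF. -/
theorem Cutoff_subset_decidedByDAF (Λ : Type*) [Finite Λ] : Cutoff Λ ⊆ decidedByDAF Λ := by
  rintro φ ⟨K, hK⟩
  obtain ⟨n, ⟨e⟩⟩ := Finite.exists_equiv_fin Λ
  -- the component `(a, j)` decides whether more than `j` nodes carry the label number `a`
  let M : Fin n × Fin K → Machine Λ 1 := fun i => thresholdMachine (e.symm i.1) (i.2 + 1)
  let Y : Set (∀ i, (M i).Q) := {q | φ fun y => {j : Fin K | q (e y, j) ∈ (M (e y, j)).Y}.ncard}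
  have hrun : ∀ (G : LGraph Λ) (σ : ℕ → Set G.V), FairSchedule σ → ∃ t, ∀ t' ≥ t, ∀ v i,
      ((M i).run G σ t' v ∈ (M i).Y ↔ (i.2 : ℕ) < G.labelCount (e.symm i.1)) := by
    intro G σ hσ
    have hi : ∀ i, ∃ t, ∀ t' ≥ t, ∀ v,
        ((M i).run G σ t' v ∈ (M i).Y ↔ (i.2 : ℕ) < G.labelCount (e.symm i.1)) := by
      intro i
      by_cases h : (i.2 : ℕ) < G.labelCount (e.symm i.1)
      · obtain ⟨t, ht⟩ := thresholdMachine.acceptingRun (Nat.succ_ne_zero _) h hσ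
        exact ⟨t, fun t' ht' v => iff_of_true (ht t' ht' v) h⟩
      · obtain ⟨t, ht⟩ := thresholdMachine.rejectingRun (x := e.symm i.1) (k := i.2 + 1)
          (by omega) hσ
        exact ⟨t, fun t' ht' v => iff_of_false (ht t' ht' v) h⟩
    choose t ht using hi
    obtain ⟨T, hT⟩ := (Set.finite_range t).bddAbove
    exact ⟨T, fun t' ht' v i => ht i t' ((hT ⟨i, rfl⟩).trans ht') v⟩
  have hY : ∀ (G : LGraph Λ) (σ : ℕ → Set G.V), FairSchedule σ → ∃ t, ∀ t' ≥ t, ∀ v,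
      ((prodMachine M Y).run G σ t' v ∈ Y ↔ φ G.labelCount) := by
    intro G σ hσ
    obtain ⟨t, ht⟩ := hrun G σ hσ
    refine ⟨t, fun t' ht' v => ?_⟩
    rw [hK G.labelCount]
    change φ _ ↔ φ _
    suffices (fun y => {j : Fin K | (prodMachine M Y).run G σ t' v (e y, j) ∈ (M (e y, j)).Y}.ncard) =
        cutoff K G.labelCount by rw [this]
    ext y
    have hset : {j : Fin K | (prodMachine M Y).run G σ t' v (e y, j) ∈ (M (e y, j)).Y} =
        {j : Fin K | (j : ℕ) < G.labelCount y} := by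
      ext j
      have := ht t' ht' v (e y, j)
      rw [Equiv.symm_apply_apply] at this
      rw [Set.mem_ofPred_eq, prodMachine_run]
      exact this
    rw [hset, ← Set.ncard_image_of_injective _ Fin.val_injective]
    have : Fin.val '' {j : Fin K | (j : ℕ) < G.labelCount y} =
        (Finset.range (cutoff K G.labelCount y) : Set ℕ) := by
      ext j
      simp only [cutoff, Set.mem_image, Set.mem_ofPred_eq, Finset.coe_range, Set.mem_Iio, lt_min_iff]
      constructor
      · rintro ⟨i, hi, rfl⟩
        exact ⟨hi, i.2⟩
      · rintro ⟨h1, h2⟩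
        exact ⟨⟨j, h2⟩, h1, rfl⟩
    rw [this, Set.ncard_coe_finset, Finset.card_range]
  have hacc : ∀ G : LGraph Λ, φ G.labelCount → ∀ σ, FairSchedule σ →
      (prodMachine M Y).AcceptingRun ((prodMachine M Y).run G σ) := by
    intro G hG σ hσ
    obtain ⟨t, ht⟩ := hY G σ hσ
    exact ⟨t, fun t' ht' v => (ht t' ht' v).2 hG⟩
  have hrej : ∀ G : LGraph Λ, ¬ φ G.labelCount → ∀ σ, FairSchedule σ →
      (prodMachine M Y).RejectingRun ((prodMachine M Y).run G σ) := by
    intro G hG σ hσ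
    obtain ⟨t, ht⟩ := hY G σ hσ
    exact ⟨t, fun t' ht' v h => hG ((ht t' ht' v).1 h)⟩
  refine ⟨⟨prodMachine M Y, exclusiveScheduler Λ, fun G => ?_⟩, fun _ => rfl, fun _ => rfl,
    fun G => ⟨?_, fun hG => ?_⟩⟩
  · by_cases hG : φ G.labelCount
    exacts [Or.inl (hacc G hG), Or.inr (hrej G hG)]
  · rintro ⟨σ, hσ, ha⟩
    by_contra hG
    exact Automaton.not_accepting_and_rejecting ha (hrej G hG σ hσ)
  · have := G.connected.nonempty
    obtain ⟨σ, hσ⟩ := exists_fairSchedule G.V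
    exact ⟨σ, hσ, hacc G hG σ hσ⟩

end DistAut

theorem mainTheorem4 (Λ : Type*) [Finite Λ] :
    DistAut.decidedByDAF Λ = DistAut.Cutoff Λ := by
  exact (DistAut.decidedByDAF_subset_Cutoff Λ).antisymm (DistAut.Cutoff_subset_decidedByDAF Λ)
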